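/- Let $K$ be an infinite field of characteristic different from $2$ and $3$, and let $(A,\omega)$ be a Bernstein algebra over $K$, that is, $A$ is a commutative (not necessarily associative, unital or finite-dimensional) $K$-algebra and $\omega : A \to K$ is a nonzero algebra homomorphism such that $(x^2)^2=\omega(x)^2x^2$ for all $x\in A$. Let $N=\ker(\omega)$. A subalgebra of $A$ is a linear subspace closed under multiplication. A family of subalgebras satisfies the a.c.c. (resp. d.c.c.) if it contains no infinite strictly ascending (resp. strictly descending) chain $S_0\subsetneq S_1\subsetneq\cdots$ (resp. $S_0\supsetneq S_1\supsetneq\cdots$). Then the following conditions are equivalent: (i) the family of all subalgebras of $A$ satisfies the a.c.c.; (ii) the family of all subalgebras of $A$ contained in $N$ satisfies the a.c.c.; (iii) $A$ is finite-dimensional over $K$. The same equivalence holds with the a.c.c. replaced by the d.c.c. in both (i) and (ii). -/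

import Mathlib

universe u v

/-- A commutative, not necessarily associative, `K`-algebra `A` with weight function
`ω : A → K` (a nonzero algebra homomorphism) is a Bernstein algebra if
`(x ^ 2) ^ 2 = ω(x) ^ 2 x ^ 2` holds for all `x` in `A`. -/
structure IsBernstein {K : Type u} [Field K] {A : Type v} [NonUnitalNonAssocCommRing A]
    [Module K A] [IsScalarTower K A A] [SMulCommClass K A A] (ω : A →ₙₐ[K] K) : Prop where
  weight_ne_zero : ω ≠ 0
  sq_sq : ∀ x : A, (x * x) * (x * x) = (ω x) ^ 2 • (x * x)

/-- The barideal `N = ker(ω)`, as a subspace of `A`. -/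
def barideal {K : Type u} [Field K] {A : Type v} [NonUnitalNonAssocCommRing A]
    [Module K A] (ω : A →ₙₐ[K] K) : Submodule K A :=
  LinearMap.ker (ω : A →ₗ[K] K)

/-- A family `F` of subalgebras satisfies the a.c.c.: there is no infinite strictly ascending
chain of members of `F`. -/
def SubalgebraACC {K : Type u} [Field K] {A : Type v} [NonUnitalNonAssocCommRing A]
    [Module K A] (F : Set (NonUnitalSubalgebra K A)) : Prop :=
  ¬ ∃ S : ℕ → NonUnitalSubalgebra K A, (∀ n, S n ∈ F) ∧ ∀ n, S n < S (n + 1)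

/-- A family `F` of subalgebras satisfies the d.c.c.: there is no infinite strictly descending
chain of members of `F`. -/
def SubalgebraDCC {K : Type u} [Field K] {A : Type v} [NonUnitalNonAssocCommRing A]
    [Module K A] (F : Set (NonUnitalSubalgebra K A)) : Prop :=
  ¬ ∃ S : ℕ → NonUnitalSubalgebra K A, (∀ n, S n ∈ F) ∧ ∀ n, S (n + 1) < S n

/-! The chain conditions enter only through one principle (`SubalgebraACC.fg_of_mul_mem`,
`SubalgebraDCC.fg_of_mul_mem`): if `P ≤ Q ≤ N` and `Q * Q ⊆ P`, every subspace between `P` and `Q`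
is a subalgebra, so `Q / P` is finite-dimensional, and `Q` is too once `P` is.

An idempotent `e` of weight 1 splits `N = U ⊕ V` into the eigenspaces of `e` for `1 / 2` and `0`.
The Bernstein identity gives `U² ⊆ V`, `UV ⊆ U`, `V² ⊆ U`, `U V² = 0` and `(uv)(uv') = (uv)(u'v) =
0`. Hence `V²`, `uV` and `Uv` have zero multiplication and, by the principle with `P = 0`, finite
dimension. From these one gets `V`, then `UV`, then `U ⊕ V` with `P = V + UV + V²`; finally `N` has
codimension 1. -/

/-- Linear functionals reduce this to scalar polynomials vanishing on an infinite field. -/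
theorem eq_zero_of_forall_sum_pow_smul_eq_zero {K M : Type*} [Field K] [Infinite K]
    [AddCommGroup M] [Module K M] {n : ℕ} {c : ℕ → M}
    (h : ∀ t : K, ∑ i ∈ Finset.range n, t ^ i • c i = 0) {i : ℕ} (hi : i < n) : c i = 0 := by
  rw [← Module.forall_dual_apply_eq_zero_iff K]
  intro f
  have hp : (∑ j ∈ Finset.range n, Polynomial.C (f (c j)) * Polynomial.X ^ j) = 0 := by
    refine Polynomial.funext fun t => ?_
    have := congrArg f (h t)
    simpa only [Polynomial.eval_finsetSum, Polynomial.eval_mul, Polynomial.eval_C,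
      Polynomial.eval_pow, Polynomial.eval_X, Polynomial.eval_zero, map_sum, map_smul, map_zero,
      smul_eq_mul, mul_comm] using this
  have := congrArg (fun p => Polynomial.coeff p i) hp
  simpa [Polynomial.finsetSum_coeff, Polynomial.coeff_C_mul, Polynomial.coeff_X_pow, hi]
    using this

/-! ### Chain conditions and finite dimension -/

section Chains

variable {K : Type*} [Field K] {A : Type*} [NonUnitalNonAssocCommRing A] [Module K A]

/-- Every submodule of `A` lying between `P` and `Q` is a subalgebra if `Q * Q ⊆ P`. -/
def intermediateSubalgebra {P Q : Submodule K A} (hPQ : P ≤ Q)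
    (hmul : ∀ x ∈ Q, ∀ y ∈ Q, x * y ∈ P) (W : Submodule K Q) : NonUnitalSubalgebra K A where
  __ := P ⊔ W.map Q.subtype
  mul_mem' {x y} hx hy :=
    have hle : P ⊔ W.map Q.subtype ≤ Q := sup_le hPQ (Submodule.map_subtype_le Q W)
    (le_sup_left : P ≤ P ⊔ W.map Q.subtype) (hmul x (hle hx) y (hle hy))

theorem intermediateSubalgebra_toSubmodule {P Q : Submodule K A} (hPQ : P ≤ Q)
    (hmul : ∀ x ∈ Q, ∀ y ∈ Q, x * y ∈ P) (W : Submodule K Q) :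
    (intermediateSubalgebra hPQ hmul W).toSubmodule = P ⊔ W.map Q.subtype := rfl

theorem intermediateSubalgebra_le {P Q : Submodule K A} (hPQ : P ≤ Q)
    (hmul : ∀ x ∈ Q, ∀ y ∈ Q, x * y ∈ P) (W : Submodule K Q) :
    (intermediateSubalgebra hPQ hmul W).toSubmodule ≤ Q :=
  sup_le hPQ (Submodule.map_subtype_le Q W)

theorem intermediateSubalgebra_comap_mkQ_strictMono {P Q : Submodule K A} (hPQ : P ≤ Q)
    (hmul : ∀ x ∈ Q, ∀ y ∈ Q, x * y ∈ P) :
    StrictMono fun W : Submodule K (Q ⧸ P.comap Q.subtype) =>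
      intermediateSubalgebra hPQ hmul (W.comap (P.comap Q.subtype).mkQ) := by
  have key : ∀ W : Submodule K (Q ⧸ P.comap Q.subtype),
      (intermediateSubalgebra hPQ hmul (W.comap (P.comap Q.subtype).mkQ)).toSubmodule =
        (W.comap (P.comap Q.subtype).mkQ).map Q.subtype := by
    intro W
    rw [intermediateSubalgebra_toSubmodule, sup_eq_right]
    intro x hx
    refine ⟨⟨x, hPQ hx⟩, ?_, rfl⟩
    have h0 : (P.comap Q.subtype).mkQ ⟨x, hPQ hx⟩ = 0 :=
      (Submodule.Quotient.mk_eq_zero _).2 hx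
    change (P.comap Q.subtype).mkQ ⟨x, hPQ hx⟩ ∈ W
    rw [h0]
    exact W.zero_mem
  have hinj : Function.Injective fun W : Submodule K (Q ⧸ P.comap Q.subtype) =>
      (W.comap (P.comap Q.subtype).mkQ).map Q.subtype :=
    (Submodule.map_injective_of_injective Q.injective_subtype).comp
      (Submodule.comap_injective_of_surjective (Submodule.mkQ_surjective _))
  refine Monotone.strictMono_of_injective (fun W₁ W₂ h => ?_) (fun W₁ W₂ h => hinj ?_)
  · change (intermediateSubalgebra hPQ hmul _).toSubmodule ≤
      (intermediateSubalgebra hPQ hmul _).toSubmodule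
    rw [key, key]
    exact Submodule.map_mono (Submodule.comap_mono h)
  · have := congrArg NonUnitalSubalgebra.toSubmodule h
    rwa [key, key] at this

/-- If `P` and `Q / P` are finite-dimensional, then `Q` is finitely generated. -/
theorem fg_of_quotient_finite {P Q : Submodule K A} (hP : P.FG)
    [Module.Finite K (Q ⧸ P.comap Q.subtype)] : Q.FG := by
  rw [← Submodule.fg_top]
  have : FiniteDimensional K P := Module.Finite.iff_fg.2 hP
  refine Submodule.fg_of_fg_map_of_fg_inf_ker (P.comap Q.subtype).mkQ
    (IsNoetherian.noetherian _) ?_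
  rw [top_inf_eq, Submodule.ker_mkQ]
  refine Submodule.fg_of_fg_map_injective Q.subtype Q.injective_subtype ?_
  rw [Submodule.map_comap_subtype]
  exact Submodule.FG.of_le hP inf_le_right

theorem SubalgebraACC.fg_of_mul_mem {N : Submodule K A}
    (h : SubalgebraACC {S : NonUnitalSubalgebra K A | S.toSubmodule ≤ N})
    {P Q : Submodule K A} (hPQ : P ≤ Q) (hQN : Q ≤ N) (hmul : ∀ x ∈ Q, ∀ y ∈ Q, x * y ∈ P)
    (hP : P.FG) : Q.FG := by
  have : IsNoetherian K (Q ⧸ P.comap Q.subtype) := by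
    rw [isNoetherian_iff', WellFoundedGT, isWellFounded_iff,
      RelEmbedding.wellFounded_iff_isEmpty]
    refine ⟨fun f => h ⟨fun n => intermediateSubalgebra hPQ hmul ((f n).comap _), fun n =>
      (intermediateSubalgebra_le hPQ hmul _).trans hQN, fun n =>
      intermediateSubalgebra_comap_mkQ_strictMono hPQ hmul (f.map_rel_iff.2 n.lt_succ_self)⟩⟩
  exact fg_of_quotient_finite hP

theorem SubalgebraDCC.fg_of_mul_mem {N : Submodule K A}
    (h : SubalgebraDCC {S : NonUnitalSubalgebra K A | S.toSubmodule ≤ N})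
    {P Q : Submodule K A} (hPQ : P ≤ Q) (hQN : Q ≤ N) (hmul : ∀ x ∈ Q, ∀ y ∈ Q, x * y ∈ P)
    (hP : P.FG) : Q.FG := by
  have : IsArtinian K (Q ⧸ P.comap Q.subtype) := by
    rw [isArtinian_iff, RelEmbedding.wellFounded_iff_isEmpty]
    refine ⟨fun f => h ⟨fun n => intermediateSubalgebra hPQ hmul ((f n).comap _), fun n =>
      (intermediateSubalgebra_le hPQ hmul _).trans hQN, fun n =>
      intermediateSubalgebra_comap_mkQ_strictMono hPQ hmul (f.map_rel_iff.2 n.lt_succ_self)⟩⟩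
  -- A vector space is semisimple, so Artinian forces finite dimension.
  have : Module.Finite K (Q ⧸ P.comap Q.subtype) :=
    ((IsSemisimpleModule.finite_tfae (R := K) (M := Q ⧸ P.comap Q.subtype)).out 0 2).2 this
  exact fg_of_quotient_finite hP

theorem SubalgebraACC.mono {F G : Set (NonUnitalSubalgebra K A)} (h : SubalgebraACC G)
    (hFG : F ⊆ G) : SubalgebraACC F :=
  fun ⟨S, hS, hlt⟩ => h ⟨S, fun n => hFG (hS n), hlt⟩

theorem SubalgebraDCC.mono {F G : Set (NonUnitalSubalgebra K A)} (h : SubalgebraDCC G)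
    (hFG : F ⊆ G) : SubalgebraDCC F :=
  fun ⟨S, hS, hlt⟩ => h ⟨S, fun n => hFG (hS n), hlt⟩

theorem subalgebraACC_of_finiteDimensional [FiniteDimensional K A]
    (F : Set (NonUnitalSubalgebra K A)) : SubalgebraACC F := by
  rintro ⟨S, -, hlt⟩
  exact (RelEmbedding.natGT (r := (· > ·)) (fun n => (S n).toSubmodule) hlt).not_wellFounded
    wellFounded_gt

theorem subalgebraDCC_of_finiteDimensional [FiniteDimensional K A]
    (F : Set (NonUnitalSubalgebra K A)) : SubalgebraDCC F := by
  rintro ⟨S, -, hlt⟩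
  exact (RelEmbedding.natGT (r := (· < ·)) (fun n => (S n).toSubmodule) hlt).not_wellFounded
    wellFounded_lt

theorem mem_barideal {ω : A →ₙₐ[K] K} {x : A} : x ∈ barideal ω ↔ ω x = 0 := Iff.rfl

end Chains

/-! ### Peirce decomposition of a Bernstein algebra -/

section Peirce

variable {K : Type*} [Field K] {A : Type*} [NonUnitalNonAssocCommRing A] [Module K A]
  [IsScalarTower K A A] [SMulCommClass K A A]

/-- The Peirce component of `e` on which `e` acts as `1 / 2`. -/
def peirceHalf (K : Type*) [Field K] {A : Type*} [NonUnitalNonAssocCommRing A] [Module K A]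
    [IsScalarTower K A A] [SMulCommClass K A A] (e : A) : Submodule K A :=
  LinearMap.ker ((2 : K) • LinearMap.mulLeft K e - LinearMap.id)

/-- The Peirce component of `e` annihilated by `e`. -/
def peirceZero (K : Type*) [Field K] {A : Type*} [NonUnitalNonAssocCommRing A] [Module K A]
    [IsScalarTower K A A] [SMulCommClass K A A] (e : A) : Submodule K A :=
  LinearMap.ker (LinearMap.mulLeft K e)

theorem mem_peirceHalf {e x : A} : x ∈ peirceHalf K e ↔ (2 : K) • (e * x) = x := by
  simp [peirceHalf, sub_eq_zero]

theorem mem_peirceZero {e x : A} : x ∈ peirceZero K e ↔ e * x = 0 := by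
  simp [peirceZero]

variable {ω : A →ₙₐ[K] K} {e : A}

/-- The square of any element of weight 1 is idempotent. -/
theorem IsBernstein.exists_idempotent (hA : IsBernstein ω) : ∃ e : A, e * e = e ∧ ω e = 1 := by
  obtain ⟨a, ha⟩ : ∃ a, ω a ≠ 0 := by
    by_contra! h
    exact hA.weight_ne_zero (NonUnitalAlgHom.ext h)
  have hb : ω ((ω a)⁻¹ • a) = 1 := by
    rw [map_smul, smul_eq_mul, inv_mul_cancel₀ ha]
  refine ⟨((ω a)⁻¹ • a) * ((ω a)⁻¹ • a), ?_, ?_⟩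
  · rw [hA.sq_sq, hb, one_pow, one_smul]
  · rw [map_mul, hb, one_mul]

theorem peirceHalf_le_barideal (he : ω e = 1) : peirceHalf K e ≤ barideal ω := by
  intro x hx
  have h := congrArg ω (mem_peirceHalf.1 hx)
  rw [map_smul, map_mul, he, one_mul, smul_eq_mul] at h
  rw [mem_barideal]
  linear_combination h

theorem peirceZero_le_barideal (he : ω e = 1) : peirceZero K e ≤ barideal ω := by
  intro x hx
  have h := congrArg ω (mem_peirceZero.1 hx)
  rwa [map_mul, he, one_mul, map_zero] at h

/-- The homogeneous components of the Bernstein identity at `e + n`, for `n` in the barideal. -/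
theorem IsBernstein.identities [Infinite K] (h2 : (2 : K) ≠ 0) (hA : IsBernstein ω)
    (hee : e * e = e) (he : ω e = 1) {n : A} (hn : n ∈ barideal ω) :
    (2 : K) • (e * (e * n)) = e * n ∧
    n * n = (2 : K) • (e * (n * n)) + (4 : K) • ((e * n) * (e * n)) ∧
    (e * n) * (n * n) = 0 ∧ (n * n) * (n * n) = 0 := by
  -- `c i` is the coefficient of `t ^ i` in `x² x² - x²` for `x = e + t n`.
  let c : ℕ → A := fun i => match i with
    | 0 => 0
    | 1 => (4 : K) • (e * (e * n)) - (2 : K) • (e * n)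
    | 2 => (2 : K) • (e * (n * n)) + (4 : K) • ((e * n) * (e * n)) - n * n
    | 3 => (4 : K) • ((e * n) * (n * n))
    | 4 => (n * n) * (n * n)
    | _ => 0
  have hc : ∀ t : K, ∑ i ∈ Finset.range 5, t ^ i • c i = 0 := by
    intro t
    have hsq : (e + t • n) * (e + t • n) = e + (2 * t) • (e * n) + t ^ 2 • (n * n) := by
      simp only [mul_add, add_mul, smul_mul_assoc, mul_smul_comm, hee, mul_comm n e]
      module
    have h := hA.sq_sq (e + t • n)
    rw [map_add, map_smul, he, mem_barideal.1 hn, smul_zero, add_zero, one_pow, one_smul, hsq,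
      ← sub_eq_zero] at h
    rw [← h]
    simp only [Finset.sum_range_succ, Finset.sum_range_zero, c, mul_add, add_mul,
      smul_mul_assoc, mul_smul_comm, hee, mul_comm (e * n) e, mul_comm (n * n) e,
      mul_comm (n * n) (e * n)]
    module
  have h4 : (4 : K) ≠ 0 := by
    have : (4 : K) = 2 * 2 := by norm_num
    rw [this]
    exact mul_ne_zero h2 h2
  have c1 : (4 : K) • (e * (e * n)) - (2 : K) • (e * n) = 0 :=
    eq_zero_of_forall_sum_pow_smul_eq_zero hc (i := 1) (by norm_num)
  have c2 : (2 : K) • (e * (n * n)) + (4 : K) • ((e * n) * (e * n)) - n * n = 0 :=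
    eq_zero_of_forall_sum_pow_smul_eq_zero hc (i := 2) (by norm_num)
  have c3 : (4 : K) • ((e * n) * (n * n)) = 0 :=
    eq_zero_of_forall_sum_pow_smul_eq_zero hc (i := 3) (by norm_num)
  have c4 : (n * n) * (n * n) = 0 :=
    eq_zero_of_forall_sum_pow_smul_eq_zero hc (i := 4) (by norm_num)
  refine ⟨?_, (sub_eq_zero.1 c2).symm, (smul_eq_zero.1 c3).resolve_left h4, c4⟩
  refine smul_right_injective A h2 ?_
  beta_reduce
  linear_combination (norm := module) c1

/-- On `N`, twice multiplication by `e` is a projection with image `U` and kernel `V`. -/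
theorem IsBernstein.barideal_le_sup [Infinite K] (h2 : (2 : K) ≠ 0) (hA : IsBernstein ω)
    (hee : e * e = e) (he : ω e = 1) : barideal ω ≤ peirceHalf K e ⊔ peirceZero K e := by
  intro n hn
  have h := (hA.identities h2 hee he hn).1
  refine Submodule.mem_sup.2 ⟨(2 : K) • (e * n), ?_, n - (2 : K) • (e * n), ?_, by abel⟩
  · rw [mem_peirceHalf, mul_smul_comm, h]
  · rw [mem_peirceZero, mul_sub, mul_smul_comm, h, sub_self]

theorem IsBernstein.mul_eq [Infinite K] (h2 : (2 : K) ≠ 0) (hA : IsBernstein ω)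
    (hee : e * e = e) (he : ω e = 1) {m n : A} (hm : m ∈ barideal ω) (hn : n ∈ barideal ω) :
    m * n = (2 : K) • (e * (m * n)) + (4 : K) • ((e * m) * (e * n)) := by
  have h := (hA.identities h2 hee he (add_mem hm hn)).2.1
  have hm' := (hA.identities h2 hee he hm).2.1
  have hn' := (hA.identities h2 hee he hn).2.1
  simp only [mul_add, add_mul, mul_comm n m, mul_comm (e * n) (e * m)] at h
  refine smul_right_injective A h2 ?_
  beta_reduce
  linear_combination (norm := module) h - hm' - hn'

/-! ### Multiplication rules for the Peirce components -/

variable [Infinite K] (h2 : (2 : K) ≠ 0) (hA : IsBernstein ω) (hee : e * e = e) (he : ω e = 1)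
  {u u' v v' : A}

include h2 hA hee he

theorem IsBernstein.half_mul_half (hu : u ∈ peirceHalf K e) (hu' : u' ∈ peirceHalf K e) :
    u * u' ∈ peirceZero K e := by
  have h := hA.mul_eq h2 hee he (peirceHalf_le_barideal he hu) (peirceHalf_le_barideal he hu')
  have hp : u * u' = (4 : K) • ((e * u) * (e * u')) := by
    nth_rw 1 [← mem_peirceHalf.1 hu, ← mem_peirceHalf.1 hu']
    rw [smul_mul_smul_comm]
    norm_num
  rw [← hp, right_eq_add, smul_eq_zero] at h
  exact mem_peirceZero.2 (h.resolve_left h2)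

theorem IsBernstein.half_mul_zero (hu : u ∈ peirceHalf K e) (hv : v ∈ peirceZero K e) :
    u * v ∈ peirceHalf K e := by
  have h := hA.mul_eq h2 hee he (peirceHalf_le_barideal he hu) (peirceZero_le_barideal he hv)
  rw [mem_peirceZero.1 hv, mul_zero, smul_zero, add_zero] at h
  exact mem_peirceHalf.2 h.symm

theorem IsBernstein.zero_mul_zero (hv : v ∈ peirceZero K e) (hv' : v' ∈ peirceZero K e) :
    v * v' ∈ peirceHalf K e := by
  have h := hA.mul_eq h2 hee he (peirceZero_le_barideal he hv) (peirceZero_le_barideal he hv')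
  rw [mem_peirceZero.1 hv, zero_mul, smul_zero, add_zero] at h
  exact mem_peirceHalf.2 h.symm

/-- Since `e (u + w) = e u = u / 2`, the cubic identity at `u + w` reads `u (u + w)² = 0`; take the
part quadratic in `w`. -/
theorem IsBernstein.half_mul_sq_zero (hu : u ∈ peirceHalf K e) (hv : v ∈ peirceZero K e) :
    u * (v * v) = 0 := by
  have key : ∀ w ∈ peirceZero K e, u * ((u + w) * (u + w)) = 0 := by
    intro w hw
    have h := (hA.identities h2 hee he
      (add_mem (peirceHalf_le_barideal he hu) (peirceZero_le_barideal he hw))).2.2.1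
    rw [mul_add e, mem_peirceZero.1 hw, add_zero] at h
    rw [← mem_peirceHalf.1 hu, smul_mul_assoc, mem_peirceHalf.1 hu, h, smul_zero]
  have h0 := key 0 (zero_mem _)
  have h1 := key v hv
  have h3 := key (-v) (neg_mem hv)
  simp only [mul_add, add_mul, add_zero, mul_neg, neg_mul, mul_comm v u] at h0 h1 h3
  refine (smul_eq_zero.1 (?_ : (2 : K) • (u * (v * v)) = 0)).resolve_left h2
  linear_combination (norm := module) h1 + h3 - (2 : K) • h0

theorem IsBernstein.half_mul_mul_zero (hu : u ∈ peirceHalf K e) (hv : v ∈ peirceZero K e)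
    (hv' : v' ∈ peirceZero K e) : u * (v * v') = 0 := by
  have h := hA.half_mul_sq_zero h2 hee he hu (add_mem hv hv')
  have h0 := hA.half_mul_sq_zero h2 hee he hu hv
  have h1 := hA.half_mul_sq_zero h2 hee he hu hv'
  simp only [mul_add, add_mul, mul_comm v' v] at h
  refine (smul_eq_zero.1 (?_ : (2 : K) • (u * (v * v')) = 0)).resolve_left h2
  linear_combination (norm := module) h - h0 - h1

/-- The part of the quartic identity at `u + v` quadratic in `v` gives `2 (uv)² + u² v² = 0`. The
first term lies in `V` and the second in `U`, so both vanish. -/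
theorem IsBernstein.sq_half_mul_zero (hu : u ∈ peirceHalf K e) (hv : v ∈ peirceZero K e) :
    (u * v) * (u * v) = 0 := by
  have hu0 := (hA.identities h2 hee he (peirceHalf_le_barideal he hu)).2.2.2
  have hv0 := (hA.identities h2 hee he (peirceZero_le_barideal he hv)).2.2.2
  have key : ∀ w ∈ peirceZero K e, ((u + w) * (u + w)) * ((u + w) * (u + w)) = 0 := fun w hw =>
    (hA.identities h2 hee he
      (add_mem (peirceHalf_le_barideal he hu) (peirceZero_le_barideal he hw))).2.2.2
  have h1 := key v hv
  have h3 := key (-v) (neg_mem hv)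
  simp only [mul_add, add_mul, mul_neg, neg_mul, mul_comm v u, hu0, hv0,
    mul_comm (v * v) (u * u), mul_comm (u * v) (u * u), mul_comm (v * v) (u * v)] at h1 h3
  have hs : (2 : K) • ((2 : K) • ((u * v) * (u * v)) + (u * u) * (v * v)) = 0 := by
    refine smul_right_injective A h2 ?_
    beta_reduce
    linear_combination (norm := module) h1 + h3
  have hs := (smul_eq_zero.1 hs).resolve_left h2
  have huv := hA.half_mul_zero h2 hee he hu hv
  have hz := mem_peirceZero.1 (hA.half_mul_half h2 hee he huv huv)
  have hh : (u * u) * (v * v) ∈ peirceHalf K e := by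
    rw [mul_comm]
    exact hA.half_mul_zero h2 hee he (hA.zero_mul_zero h2 hee he hv hv)
      (hA.half_mul_half h2 hee he hu hu)
  have h0 := congrArg (e * ·) hs
  simp only [mul_add, mul_smul_comm, hz, smul_zero, zero_add, mul_zero] at h0
  rw [← mem_peirceHalf.1 hh, h0, smul_zero, add_zero] at hs
  exact (smul_eq_zero.1 hs).resolve_left h2

theorem IsBernstein.half_mul_zero_mul_half_mul_zero_left (hu : u ∈ peirceHalf K e)
    (hv : v ∈ peirceZero K e) (hv' : v' ∈ peirceZero K e) : (u * v) * (u * v') = 0 := by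
  have h := hA.sq_half_mul_zero h2 hee he hu (add_mem hv hv')
  have h0 := hA.sq_half_mul_zero h2 hee he hu hv
  have h1 := hA.sq_half_mul_zero h2 hee he hu hv'
  simp only [mul_add, add_mul, mul_comm (u * v') (u * v)] at h
  refine (smul_eq_zero.1 (?_ : (2 : K) • ((u * v) * (u * v')) = 0)).resolve_left h2
  linear_combination (norm := module) h - h0 - h1

theorem IsBernstein.half_mul_zero_mul_half_mul_zero_right (hu : u ∈ peirceHalf K e)
    (hu' : u' ∈ peirceHalf K e) (hv : v ∈ peirceZero K e) : (u * v) * (u' * v) = 0 := by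
  have h := hA.sq_half_mul_zero h2 hee he (add_mem hu hu') hv
  have h0 := hA.sq_half_mul_zero h2 hee he hu hv
  have h1 := hA.sq_half_mul_zero h2 hee he hu' hv
  simp only [mul_add, add_mul, mul_comm (u' * v) (u * v)] at h
  refine (smul_eq_zero.1 (?_ : (2 : K) • ((u * v) * (u' * v)) = 0)).resolve_left h2
  linear_combination (norm := module) h - h0 - h1

/-- A Bernstein algebra is finite-dimensional as soon as finite generation passes from `P` to
`Q` for all subspaces `P ≤ Q` of the barideal with `Q * Q ⊆ P`. -/
theorem IsBernstein.finiteDimensional_of_fg_of_mul_mem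
    (hfg : ∀ P Q : Submodule K A, P ≤ Q → Q ≤ barideal ω → (∀ x ∈ Q, ∀ y ∈ Q, x * y ∈ P) →
      P.FG → Q.FG) : FiniteDimensional K A := by
  let U := peirceHalf K e
  let V := peirceZero K e
  have hUN : U ≤ barideal ω := peirceHalf_le_barideal he
  have hVN : V ≤ barideal ω := peirceZero_le_barideal he
  let VV := Submodule.map₂ (LinearMap.mul K A) V V
  let UV := Submodule.map₂ (LinearMap.mul K A) U V
  have hVVU : VV ≤ U := Submodule.map₂_le.2 fun v hv v' hv' =>
    hA.zero_mul_zero h2 hee he hv hv'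
  have hUVU : UV ≤ U := Submodule.map₂_le.2 fun u hu v hv => hA.half_mul_zero h2 hee he hu hv
  have hU_VV : ∀ u ∈ U, ∀ x ∈ VV, u * x = 0 := fun u hu => by
    have : VV ≤ LinearMap.ker (LinearMap.mulLeft K u) := Submodule.map₂_le.2 fun v hv v' hv' =>
      hA.half_mul_mul_zero h2 hee he hu hv hv'
    exact fun x hx => this hx
  have hVV : VV.FG := hfg ⊥ VV bot_le (hVVU.trans hUN)
    (fun x hx y hy => (Submodule.mem_bot K).2 (hU_VV x (hVVU hx) y hy)) Submodule.fg_bot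
  have huV : ∀ u ∈ U, (V.map (LinearMap.mulLeft K u)).FG := by
    intro u hu
    refine hfg ⊥ _ bot_le ?_ ?_ Submodule.fg_bot
    · rintro _ ⟨v, hv, rfl⟩
      exact hUN (hA.half_mul_zero h2 hee he hu hv)
    · rintro _ ⟨v, hv, rfl⟩ _ ⟨v', hv', rfl⟩
      exact hA.half_mul_zero_mul_half_mul_zero_left h2 hee he hu hv hv'
  have hUv : ∀ v ∈ V, (U.map (LinearMap.mulRight K v)).FG := by
    intro v hv
    refine hfg ⊥ _ bot_le ?_ ?_ Submodule.fg_bot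
    · rintro _ ⟨u, hu, rfl⟩
      exact hUN (hA.half_mul_zero h2 hee he hu hv)
    · rintro _ ⟨u, hu, rfl⟩ _ ⟨u', hu', rfl⟩
      exact hA.half_mul_zero_mul_half_mul_zero_right h2 hee he hu hu' hv
  -- Annihilating finitely many elements of `U` cuts out finite codimension in `W`, as each `uV` is
  -- finite-dimensional.
  have hann : ∀ s : Finset A, (s : Set A) ⊆ U → ∀ W ≤ V,
      (W ⊓ ⨅ x ∈ s, LinearMap.ker (LinearMap.mulLeft K x)).FG → W.FG := by
    classical
    intro s
    induction s using Finset.induction_on with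
    | empty => intro _ W _ h; simpa using h
    | insert a s _ ih =>
      intro hs W hW h
      rw [Finset.coe_insert, Set.insert_subset_iff] at hs
      rw [Finset.iInf_insert, ← inf_assoc] at h
      have := ih hs.2 _ (inf_le_left.trans hW) h
      exact Submodule.fg_of_fg_map_of_fg_inf_ker (LinearMap.mulLeft K a)
        ((huV a hs.1).of_le (Submodule.map_mono hW)) this
  have hV : V.FG := by
    obtain ⟨s, hs⟩ := hVV
    have hsVV : (s : Set A) ⊆ VV := hs ▸ Submodule.subset_span
    refine hann s (hsVV.trans hVVU) V le_rfl ?_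
    -- `V₀` annihilates the spanning set `s` of `V²`, hence `V²`; so `V² + V₀` squares into `V²` and
    -- the principle applies.
    set V₀ := V ⊓ ⨅ x ∈ s, LinearMap.ker (LinearMap.mulLeft K x)
    have hV₀ : ∀ x ∈ VV, ∀ v ∈ V₀, x * v = 0 := by
      intro x hx v hv
      have : VV ≤ LinearMap.ker (LinearMap.mulRight K v) := by
        rw [← hs, Submodule.span_le]
        intro y hy
        exact (Submodule.mem_iInf _).1 ((Submodule.mem_iInf _).1 hv.2 y) hy
      exact this hx
    have hQ : (VV ⊔ V₀).FG := by
      refine hfg VV _ le_sup_left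
        (sup_le (hVVU.trans hUN) (inf_le_left.trans hVN)) ?_ ⟨s, hs⟩
      intro x hx y hy
      obtain ⟨a, ha, b, hb, rfl⟩ := Submodule.mem_sup.1 hx
      obtain ⟨c, hc, d, hd, rfl⟩ := Submodule.mem_sup.1 hy
      rw [mul_add, add_mul, add_mul, hU_VV a (hVVU ha) c hc, hV₀ a ha d hd, mul_comm b c,
        hV₀ c hc b hb, zero_add, zero_add, zero_add]
      exact Submodule.apply_mem_map₂ (LinearMap.mul K A) hb.1 hd.1
    exact hQ.of_le le_sup_right
  have hUV : UV.FG := by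
    obtain ⟨s, hs⟩ := hV
    have hsV : ∀ v ∈ s, v ∈ V := fun v hv => hs ▸ Submodule.subset_span hv
    -- `UV` is the finite sum of the `Uv` over a spanning set of `V`.
    refine (Submodule.fg_biSup s (fun v => U.map (LinearMap.mulRight K v))
      fun v hv => hUv v (hsV v hv)).of_le (Submodule.map₂_le.2 fun u hu v hv => ?_)
    have : V ≤ (⨆ v ∈ s, U.map (LinearMap.mulRight K v)).comap (LinearMap.mulLeft K u) := by
      rw [← hs, Submodule.span_le]
      intro w hw
      exact Submodule.mem_iSup_of_mem w (Submodule.mem_iSup_of_mem hw ⟨u, hu, rfl⟩)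
    exact this hv
  have hN : (U ⊔ V).FG := by
    refine hfg (V ⊔ UV ⊔ VV) _
      (sup_le (sup_le le_sup_right (hUVU.trans le_sup_left)) (hVVU.trans le_sup_left))
      (sup_le hUN hVN) ?_ ((hV.sup hUV).sup hVV)
    have hVF : V ≤ V ⊔ UV ⊔ VV := le_sup_left.trans le_sup_left
    have hUVF : UV ≤ V ⊔ UV ⊔ VV := le_sup_right.trans le_sup_left
    intro x hx y hy
    obtain ⟨a, ha, b, hb, rfl⟩ := Submodule.mem_sup.1 hx
    obtain ⟨c, hc, d, hd, rfl⟩ := Submodule.mem_sup.1 hy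
    rw [mul_add, add_mul, add_mul, mul_comm b c]
    exact add_mem
      (add_mem (hVF (hA.half_mul_half h2 hee he ha hc))
        (hUVF (Submodule.apply_mem_map₂ (LinearMap.mul K A) hc hb)))
      (add_mem (hUVF (Submodule.apply_mem_map₂ (LinearMap.mul K A) ha hd))
        ((le_sup_right : VV ≤ _) (Submodule.apply_mem_map₂ (LinearMap.mul K A) hb hd)))
  refine ⟨Submodule.fg_of_fg_map_of_fg_inf_ker (ω : A →ₗ[K] K) (IsNoetherian.noetherian _) ?_⟩
  rw [top_inf_eq]
  exact hN.of_le (hA.barideal_le_sup h2 hee he)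

end Peirce

theorem theorem2p1 {K : Type u} [Field K] [Infinite K] (h2 : (2 : K) ≠ 0) (h3 : (3 : K) ≠ 0)
    {A : Type v} [NonUnitalNonAssocCommRing A] [Module K A] [IsScalarTower K A A]
    [SMulCommClass K A A] (ω : A →ₙₐ[K] K) (hA : IsBernstein ω) :
    List.TFAE
      [SubalgebraACC (Set.univ : Set (NonUnitalSubalgebra K A)),
       SubalgebraACC {S : NonUnitalSubalgebra K A | S.toSubmodule ≤ barideal ω},
       FiniteDimensional K A] ∧
    List.TFAE
      [SubalgebraDCC (Set.univ : Set (NonUnitalSubalgebra K A)),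
       SubalgebraDCC {S : NonUnitalSubalgebra K A | S.toSubmodule ≤ barideal ω},
       FiniteDimensional K A] := by
  obtain ⟨e, hee, he⟩ := hA.exists_idempotent
  constructor
  · tfae_have 1 → 2 := fun h => h.mono (Set.subset_univ _)
    tfae_have 2 → 3 := fun h => hA.finiteDimensional_of_fg_of_mul_mem h2 hee he
      fun _ _ hPQ hQN hmul hP => h.fg_of_mul_mem hPQ hQN hmul hP
    tfae_have 3 → 1 := fun _ => subalgebraACC_of_finiteDimensional _
    tfae_finish
  · tfae_have 1 → 2 := fun h => h.mono (Set.subset_univ _)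
    tfae_have 2 → 3 := fun h => hA.finiteDimensional_of_fg_of_mul_mem h2 hee he
      fun _ _ hPQ hQN hmul hP => h.fg_of_mul_mem hPQ hQN hmul hP
    tfae_have 3 → 1 := fun _ => subalgebraDCC_of_finiteDimensional _
    tfae_finish
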